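/- Let $L$ be a countable first-order language with a distinguished binary relation symbol $<$, and let $T$ be a complete (in particular satisfiable) first-order $L$-theory such that (a) $T$ proves that $<$ is a (strict) linear order; (b) $T$ has built-in Skolem functions: for every $L$-formula $\varphi(\bar x,y)$ with $\bar x$ a nonempty finite tuple of variables there is an $L$-term $t(\bar x)$ such that $T\vdash\forall\bar x\,\bigl(\exists y\,\varphi(\bar x,y)\rightarrow\varphi(\bar x,t(\bar x))\bigr)$; (c) $T$ satisfies the inaccessibility scheme: for every $L$-formula $\varphi(\bar x,\bar t)$, where $\bar x$ and $\bar t$ are finite tuples of variables of arbitrary lengths, $$T\vdash(\forall z_0)(\exists z_1>z_0)(\forall\bar y_0)(\exists\bar y_1<z_1)(\forall\bar t<z_0)\bigl(\varphi(\bar y_0,\bar t)\leftrightarrow\varphi(\bar y_1,\bar t)\bigr),$$ where $\bar y_0,\bar y_1$ have the same length as $\bar x$, and $\bar u<z$ means that every entry of the tuple $\bar u$ is $<z$. For a model $K$ of $T$ write $\mathrm{cof}(K)=\kappa$ if $\kappa$ is the least cardinal such that there is a strictly increasing cofinal sequence of elements of $K$ of length $\kappa$. Let $M$ be a model of $T$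 with $\mathrm{cof}(M)=\omega$. Then $M$ has a (proper) elementary end extension $N$, that is, an elementary extension $N\succ M$ with $N\neq M$ in which every element of $N\setminus M$ is greater than every element of $M$, such that $|N|=|M|$ and $\mathrm{cof}(N)=\omega$. -/

import Mathlib

open scoped FirstOrder

universe u v w

namespace InaccScheme

open FirstOrder FirstOrder.Language

variable {L : FirstOrder.Language.{u, v}}

/-- The atomic formula `a < b`, for variables `a` and `b`; `lt` is the symbol `<` of `L`. -/
def ltFormula (lt : L.Relations 2) {α : Type} (a b : α) : L.Formula α :=
  lt.formula₂ (Term.var a) (Term.var b)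

/-- The sentence `∀ x y, x < y ∨ x = y ∨ y < x`. -/
noncomputable def trichotomous (lt : L.Relations 2) : L.Sentence :=
  Formula.iAlls (Fin 2)
    (ltFormula lt (Sum.inr 0) (Sum.inr 1) ⊔
      (Term.equal (Term.var (Sum.inr 0)) (Term.var (Sum.inr 1)) ⊔
        ltFormula lt (Sum.inr 1) (Sum.inr 0)))

/-- `T` proves that `<` is a (strict) linear order. -/
def ProvesLinearOrder (T : L.Theory) (lt : L.Relations 2) : Prop :=
  T ⊨ᵇ lt.irreflexive ∧ T ⊨ᵇ lt.transitive ∧ T ⊨ᵇ trichotomous lt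

/-- `T` has (built-in) Skolem functions: for every formula `φ(x₀, …, xₙ, y)` of `L` there is a term
`t(x₀, …, xₙ)` of `L` such that `T ⊢ ∀ x̄ (∃ y φ(x̄, y) → φ(x̄, t(x̄)))`. The tuple `x̄` is nonempty, so
closed terms are not required to exist. -/
def HasSkolemFunctions (T : L.Theory) : Prop :=
  ∀ (n : ℕ) (φ : L.Formula (Fin (n + 1) ⊕ Unit)), ∃ t : L.Term (Fin (n + 1)),
    T ⊨ᵇ (Formula.iExs Unit φ).imp (φ.subst (Sum.elim Term.var (fun _ => t)))

/-- The formula `x̄ < z`, that is, `x₀ < z ∧ ⋯ ∧ xₙ₋₁ < z`, for a tuple of variables `x̄`. -/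
noncomputable def tupleLt (lt : L.Relations 2) {α : Type} {n : ℕ} (x : Fin n → α) (z : α) :
    L.Formula α :=
  Formula.iInf fun i => ltFormula lt (x i) z

/-- For a formula `φ(x̄, t̄)` of `L`, the formula
`E_φ(ȳ₀, ȳ₁; z₀) = (∀ t̄ < z₀) (φ(ȳ₀, t̄) ↔ φ(ȳ₁, t̄))`,
with `ȳ₀`, `ȳ₁`, `z₀` variables from `α` and `t̄` a tuple of new variables. -/
noncomputable def sameType (lt : L.Relations 2) {m k : ℕ} (φ : L.Formula (Fin m ⊕ Fin k))
    {α : Type} (y₀ y₁ : Fin m → α) (z₀ : α) : L.Formula α :=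
  Formula.iAlls (Fin k)
    ((tupleLt lt (fun j => Sum.inr j) (Sum.inl z₀)).imp
      (Formula.iff (φ.relabel (Sum.elim (fun i => Sum.inl (y₀ i)) (fun j => Sum.inr j)))
        (φ.relabel (Sum.elim (fun i => Sum.inl (y₁ i)) (fun j => Sum.inr j)))))

/-- The instance at `φ(x̄, t̄)` of the inaccessibility scheme:
`∀ z₀ (∃ z₁ > z₀) ∀ ȳ₀ (∃ ȳ₁ < z₁) E_φ(ȳ₀, ȳ₁; z₀)`.
The quantified variables are, from the outside in,
`z₀ = inl (inl (inl (inr ())))`, `z₁ = inl (inl (inr ()))`, `ȳ₀ = inl (inr ·)`, `ȳ₁ = inr ·`. -/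
noncomputable def inaccessibilitySentence (lt : L.Relations 2) {m k : ℕ}
    (φ : L.Formula (Fin m ⊕ Fin k)) : L.Sentence :=
  Formula.iAlls Unit <| Formula.iExs Unit <|
    ltFormula lt (Sum.inl (Sum.inr ())) (Sum.inr ()) ⊓
      (Formula.iAlls (Fin m) <| Formula.iExs (Fin m) <|
        tupleLt lt (fun i => Sum.inr i) (Sum.inl (Sum.inl (Sum.inr ()))) ⊓
          sameType lt φ (fun i => Sum.inl (Sum.inr i)) (fun i => Sum.inr i)
            (Sum.inl (Sum.inl (Sum.inl (Sum.inr ())))))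

/-- `T` satisfies the inaccessibility scheme (for all formulas `φ(x̄, t̄)`, with tuples `x̄`, `t̄` of
any finite lengths). -/
def InaccessibilityScheme (T : L.Theory) (lt : L.Relations 2) : Prop :=
  ∀ (m k : ℕ) (φ : L.Formula (Fin m ⊕ Fin k)), T ⊨ᵇ inaccessibilitySentence lt φ

/-- The interpretation of the symbol `<` in a structure. -/
def Lt (lt : L.Relations 2) {M : Type w} [L.Structure M] (a b : M) : Prop :=
  Structure.RelMap lt ![a, b]

/-- There is a strictly increasing cofinal sequence of elements of `M` of length `κ`. -/
def HasCofinalSequence (lt : L.Relations 2) (M : Type w) [L.Structure M] (κ : Cardinal.{w}) :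
    Prop :=
  ∃ f : κ.ord.ToType → M,
    (∀ i j, i < j → Lt lt (f i) (f j)) ∧ ∀ a : M, ∃ i, Lt lt a (f i) ∨ a = f i

/-- `cof(M) = κ`: `κ` is the least cardinal such that `M` has a strictly increasing cofinal sequence
of length `κ`. -/
def HasCofinality (lt : L.Relations 2) (M : Type w) [L.Structure M] (κ : Cardinal.{w}) : Prop :=
  IsLeast {c : Cardinal.{w} | HasCofinalSequence lt M c} κ

/-- The elementary embedding `e : M → N` makes `N` a (proper) elementary end extension of `M`:
`N` has new elements, and every new element is above all elements of `M`. -/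
def IsElementaryEndExtension (lt : L.Relations 2) {M N : Type w} [L.Structure M] [L.Structure N]
    (e : M ↪ₑ[L] N) : Prop :=
  (∃ b : N, b ∉ Set.range e) ∧ ∀ (a : M) (b : N), b ∉ Set.range e → Lt lt (e a) b

end InaccScheme

/-! `N` is the Skolem hull of `M ∪ {c}` inside an ultrapower of `M`, where `c` is the class of the
identity, for an ultrafilter `U` on `M` that contains all tails and makes every bounded term
function `x ↦ t(p, x)` constant (`exists_ultrafilter`). Tails in `U` make `c` new. An element `t(p,
c)` of `N` that is not above `M` comes from a term function bounded mod `U`, hence constant, so it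
lies in `M`.

To get `U`, one shrinks unbounded definable sets. The scheme bounds a set of representatives of all
`φ`-types over an initial segment, and it also gives the bounded members of a definable family, with
parameters from an initial segment, a common bound. So the classes of same-type points in an
unbounded definable set cannot all be bounded (`exists_homogeneous`). Since `L` is countable and
`cof(M) = ω`, countably many pairs (term, initial segment) cover all parameters and bounds, so a
chain of length `ω` suffices.

The scheme also holds in `N`. There the values `t(p, c)` with `p` below a fixed element have a
bound, and countably many such bounds are cofinal (`exists_cofinal_seq`). -/

namespace InaccScheme

open FirstOrder FirstOrder.Language Filter

/-! ### The order on models and countable cofinality. -/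

section Order

variable {L : FirstOrder.Language.{u, v}} {lt : L.Relations 2} {M : Type w} [L.Structure M]

theorem realize_ltFormula {α : Type} {a b : α} {v : α → M} :
    (ltFormula lt a b).Realize v ↔ Lt lt (v a) (v b) := by
  simp [ltFormula, Lt]

theorem realize_trichotomous :
    M ⊨ trichotomous lt ↔ ∀ a b : M, Lt lt a b ∨ a = b ∨ Lt lt b a := by
  rw [Sentence.Realize, trichotomous, Formula.realize_iAlls]
  simp only [Formula.realize_sup, realize_ltFormula, Formula.realize_equal, Term.realize_var,
    Sum.elim_inr]
  exact ⟨fun h a b => h ![a, b], fun h i => h _ _⟩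

theorem realize_inaccessibilitySentence {m k : ℕ} (φ : L.Formula (Fin m ⊕ Fin k)) :
    M ⊨ inaccessibilitySentence lt φ ↔
      ∀ z₀ : M, ∃ z₁, Lt lt z₀ z₁ ∧ ∀ y₀ : Fin m → M, ∃ y₁ : Fin m → M,
        (∀ i, Lt lt (y₁ i) z₁) ∧ ∀ t : Fin k → M, (∀ j, Lt lt (t j) z₀) →
          (φ.Realize (Sum.elim y₀ t) ↔ φ.Realize (Sum.elim y₁ t)) := by
  have key : ∀ {α : Type} (y : Fin m → α) (v : α → M) (t : Fin k → M),
      (Sum.elim v t ∘ Sum.elim (fun i => Sum.inl (y i)) fun j => Sum.inr j) =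
        Sum.elim (v ∘ y) t := by
    intro α y v t
    ext (i | j) <;> rfl
  rw [Sentence.Realize, inaccessibilitySentence]
  simp only [Formula.realize_iAlls, Formula.realize_iExs, Formula.realize_inf, tupleLt, sameType,
    Formula.realize_iInf, realize_ltFormula, Formula.realize_imp, Formula.realize_iff,
    Formula.realize_relabel, key, Sum.elim_inl, Sum.elim_inr, Function.comp_def]
  constructor
  · intro h z₀
    obtain ⟨z₁, h⟩ := h fun _ => z₀
    exact ⟨z₁ (), h⟩
  · intro h z₀
    obtain ⟨z₁, h⟩ := h (z₀ ())
    exact ⟨fun _ => z₁, h⟩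

/-- The linear order on a model of a theory which proves that `<` is a linear order. -/
noncomputable abbrev linearOrder {T : L.Theory} (hlin : ProvesLinearOrder T lt) (M : Type w)
    [L.Structure M] [M ⊨ T] [Nonempty M] : LinearOrder M :=
  haveI : Std.Irrefl (Lt lt (M := M)) :=
    Relations.realize_irreflexive.1 (hlin.1.realize_sentence M)
  haveI : IsTrans M (Lt lt) := Relations.realize_transitive.1 (hlin.2.1.realize_sentence M)
  haveI : Std.Trichotomous (Lt lt (M := M)) := ⟨fun a b h₁ h₂ =>
    ((realize_trichotomous.1 (hlin.2.2.realize_sentence M) a b).resolve_left h₁).resolve_right h₂⟩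
  haveI : IsStrictTotalOrder M (Lt lt) := {}
  letI := Classical.decRel (Lt lt (M := M))
  linearOrderOfSTO (Lt lt)

theorem countable_ord_aleph0 : Countable (Cardinal.aleph0.{w}.ord.ToType) := by
  rw [← Cardinal.mk_le_aleph0_iff]
  simp

theorem HasCofinalSequence.exists_seq (h : HasCofinalSequence lt M Cardinal.aleph0) :
    ∃ a : ℕ → M, ∀ x, ∃ n, Lt lt x (a n) ∨ x = a n := by
  obtain ⟨f, -, hf⟩ := h
  have := countable_ord_aleph0.{w}
  have : Nonempty (Cardinal.aleph0.{w}.ord.ToType) := by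
    rw [← Cardinal.mk_ne_zero_iff, Cardinal.mk_ord_toType]
    exact Cardinal.aleph0_ne_zero
  obtain ⟨g, hg⟩ := exists_surjective_nat (Cardinal.aleph0.{w}.ord.ToType)
  refine ⟨f ∘ g, fun x => ?_⟩
  obtain ⟨i, hi⟩ := hf x
  obtain ⟨n, rfl⟩ := hg i
  exact ⟨n, hi⟩

theorem hasCofinality_aleph0 [LinearOrder M] [NoMaxOrder M] [Nonempty M]
    (hlt : ∀ a b : M, Lt lt a b ↔ a < b) (b : ℕ → M) (hb : ∀ x, ∃ n, x ≤ b n) :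
    HasCofinality lt M Cardinal.aleph0 := by
  constructor
  · have hstep : ∀ x y : M, ∃ z, x < z ∧ y < z := fun x y => by
      obtain ⟨z, hz⟩ := exists_gt (max x y)
      exact ⟨z, max_lt_iff.1 hz⟩
    choose s hs₁ hs₂ using hstep
    let g : ℕ → M := fun n => Nat.rec (b 0) (fun n x => s x (b n)) n
    have hg : StrictMono g := strictMono_nat_of_lt_succ fun n => hs₁ _ _
    have hty : ∀ i : Cardinal.aleph0.{w}.ord.ToType, ∃ n : ℕ,
        Ordinal.typein (α := Cardinal.aleph0.{w}.ord.ToType) (· < ·) i = n := fun i => by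
      rw [← Ordinal.lt_omega0, ← Cardinal.ord_aleph0]
      exact Ordinal.typein_lt_self i
    choose r hr using hty
    refine ⟨g ∘ r, fun i j hij => (hlt _ _).2 (hg ?_), fun a => ?_⟩
    · rw [← Nat.cast_lt (α := Ordinal.{w}), ← hr, ← hr]
      exact (Ordinal.typein_lt_typein _).2 hij
    · obtain ⟨n, hn⟩ := hb a
      -- It is `g (n + 1)`, not `g n`, that is chosen above `b n`.
      have hlt' : ((n + 1 : ℕ) : Ordinal.{w}) <
          Ordinal.type (α := Cardinal.aleph0.{w}.ord.ToType) (· < ·) := by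
        rw [Ordinal.type_toType, Cardinal.ord_aleph0]
        exact Ordinal.natCast_lt_omega0 _
      obtain ⟨i, hi⟩ := Ordinal.typein_surj _ hlt'
      refine ⟨i, Or.inl ((hlt _ _).2 ?_)⟩
      have hri : r i = n + 1 := by exact_mod_cast (hr i).symm.trans hi
      simp only [Function.comp, hri]
      exact hn.trans_lt (hs₂ _ _)
  · rintro κ ⟨f, -, hf⟩
    by_contra! hκ
    have : Finite κ.ord.ToType := by
      rw [← Cardinal.lt_aleph0_iff_finite]
      simpa using hκ
    obtain ⟨x, hx⟩ := (Set.finite_range f).bddAbove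
    obtain ⟨y, hy⟩ := exists_gt x
    obtain ⟨i, hi⟩ := hf y
    have h₁ : f i ≤ x := hx ⟨i, rfl⟩
    rcases hi with hi | rfl
    · exact absurd (h₁.trans_lt (hy.trans ((hlt _ _).1 hi))) (lt_irrefl _)
    · exact absurd (h₁.trans_lt hy) (lt_irrefl _)

end Order

/-! ### Consequences of the inaccessibility scheme. -/

section Scheme

variable {L : FirstOrder.Language.{u, v}} {lt : L.Relations 2} {M : Type w} [L.Structure M]
  [LinearOrder M]

/-- Every instance of the inaccessibility scheme holds in `M`. -/
def Inaccessible (lt : L.Relations 2) (M : Type w) [L.Structure M] : Prop :=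
  ∀ (m k : ℕ) (φ : L.Formula (Fin m ⊕ Fin k)), M ⊨ inaccessibilitySentence lt φ

theorem Inaccessible.noMaxOrder (hM : Inaccessible lt M)
    (hlt : ∀ a b : M, Lt lt a b ↔ a < b) : NoMaxOrder M :=
  ⟨fun a => by
    -- With empty tuples only the clause `z₀ < z₁` is left.
    obtain ⟨b, hb, -⟩ := (realize_inaccessibilitySentence _).1 (hM 0 0 ⊤) a
    exact ⟨b, (hlt _ _).1 hb⟩⟩

/-- All `ψ`-types over an initial segment are realized below some element. -/
theorem Inaccessible.exists_forall_exists_lt (hM : Inaccessible lt M)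
    (hlt : ∀ a b : M, Lt lt a b ↔ a < b) {β : Type} [Finite β] (ψ : L.Formula (Unit ⊕ β))
    (z₀ : M) :
    ∃ z₁, z₀ < z₁ ∧ ∀ y₀ : M, ∃ y₁ < z₁, ∀ t : β → M, (∀ j, t j < z₀) →
      (ψ.Realize (Sum.elim (fun _ => y₀) t) ↔ ψ.Realize (Sum.elim (fun _ => y₁) t)) := by
  obtain ⟨k, ⟨e⟩⟩ := Finite.exists_equiv_fin β
  obtain ⟨z₁, hz, h⟩ := (realize_inaccessibilitySentence _).1
    (hM 1 k (ψ.relabel (Sum.map (fun _ => 0) e))) z₀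
  refine ⟨z₁, (hlt _ _).1 hz, fun y₀ => ?_⟩
  obtain ⟨y₁, hy₁, h⟩ := h fun _ => y₀
  refine ⟨y₁ 0, (hlt _ _).1 (hy₁ 0), fun t ht => ?_⟩
  have key : ∀ y : Fin 1 → M, Sum.elim y (t ∘ e.symm) ∘ Sum.map (fun _ : Unit => 0) e =
      Sum.elim (fun _ => y 0) t := by
    intro y
    ext (_ | _) <;> simp
  simpa only [Formula.realize_relabel, key] using h (t ∘ e.symm) fun j => (hlt _ _).2 (ht _)

/-- The bounded members of a definable family of sets, with parameters from an initial segment,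
have a common bound. -/
theorem Inaccessible.exists_uniform_bound (hM : Inaccessible lt M)
    (hlt : ∀ a b : M, Lt lt a b ↔ a < b) {β : Type} [Finite β] (ψ : L.Formula (Unit ⊕ β))
    (z₀ : M) :
    ∃ B, ∀ r : β → M, (∀ j, r j < z₀) →
      (∃ b, ∀ x, ψ.Realize (Sum.elim (fun _ => x) r) → x < b) →
        ∀ x, ψ.Realize (Sum.elim (fun _ => x) r) → x < B := by
  -- `ρ(b, r)` says that `b` bounds the set defined by `ψ(·, r)`. Any bound can be replaced by one
  -- below `z₁` with the same `ρ`-type over `z₀`, so `z₁` itself serves as `B`.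
  let ρ : L.Formula (Unit ⊕ β) := Formula.iAlls Unit
    ((ψ.relabel (Sum.elim Sum.inr fun j => Sum.inl (Sum.inr j))).imp
      (ltFormula lt (Sum.inr ()) (Sum.inl (Sum.inl ()))))
  have hρ : ∀ (b : M) (r : β → M), ρ.Realize (Sum.elim (fun _ => b) r) ↔
      ∀ x, ψ.Realize (Sum.elim (fun _ => x) r) → x < b := by
    intro b r
    have key : ∀ i : Unit → M, (fun a => Sum.elim (Sum.elim (fun _ : Unit => b) r) i a) ∘
        Sum.elim Sum.inr (fun j => Sum.inl (Sum.inr j)) = Sum.elim (fun _ => i ()) r := by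
      intro i
      ext (_ | _) <;> rfl
    simp only [ρ, Formula.realize_iAlls, Formula.realize_imp, Formula.realize_relabel, key,
      realize_ltFormula, hlt, Sum.elim_inl, Sum.elim_inr]
    exact ⟨fun h x => h fun _ => x, fun h i => h _⟩
  obtain ⟨z₁, -, h⟩ := hM.exists_forall_exists_lt hlt ρ z₀
  refine ⟨z₁, fun r hr ⟨b, hb⟩ x hx => ?_⟩
  obtain ⟨b', hb', hbb⟩ := h b
  exact ((hρ b' r).1 ((hbb r hr).1 ((hρ b r).2 hb)) x hx).trans hb'

/-- `X` is definable in `M` with parameters. -/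
def ParamDefinable (L : FirstOrder.Language.{u, v}) {M : Type w} [L.Structure M] (X : Set M) :
    Prop :=
  ∃ (β : Type) (_ : Finite β) (ψ : L.Formula (Unit ⊕ β)) (q : β → M),
    ∀ x, x ∈ X ↔ ψ.Realize (Sum.elim (fun _ => x) q)

theorem exists_forall_lt_of_finite [NoMaxOrder M] [Nonempty M] {β : Type} [Finite β] (q : β → M) :
    ∃ z, ∀ j, q j < z := by
  obtain ⟨x, hx⟩ := (Set.finite_range q).bddAbove
  obtain ⟨y, hy⟩ := exists_gt x
  exact ⟨y, fun j => (hx ⟨j, rfl⟩).trans_lt hy⟩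

/-- An unbounded definable set has an unbounded definable subset which is homogeneous for `φ` over a
given initial segment. -/
theorem Inaccessible.exists_homogeneous (hM : Inaccessible lt M)
    (hlt : ∀ a b : M, Lt lt a b ↔ a < b) [NoMaxOrder M] [Nonempty M] {X : Set M}
    (hX : ParamDefinable L X) (hXu : ∃ᶠ x in atTop, x ∈ X) {γ : Type} [Finite γ]
    (φ : L.Formula (Unit ⊕ γ)) (a : M) :
    ∃ Y ⊆ X, ParamDefinable L Y ∧ (∃ᶠ x in atTop, x ∈ Y) ∧
      ∀ x ∈ Y, ∀ x' ∈ Y, ∀ t : γ → M, (∀ j, t j < a) →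
        (φ.Realize (Sum.elim (fun _ => x) t) ↔ φ.Realize (Sum.elim (fun _ => x') t)) := by
  obtain ⟨β, _, ψ, q, hψ⟩ := hX
  -- `E` defines the points of `X` with the same `φ`-type below `a` as `y`; the parameter `true`
  -- stands for `a` and `false` for `y`.
  let E : L.Formula (Unit ⊕ (β ⊕ Bool)) :=
    ψ.relabel (Sum.map id Sum.inl) ⊓ Formula.iAlls γ
      ((Formula.iInf fun j => ltFormula lt (Sum.inr j) (Sum.inl (Sum.inr (Sum.inr true)))).imp
        (Formula.iff (φ.relabel (Sum.elim (fun i => Sum.inl (Sum.inl i)) Sum.inr))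
          (φ.relabel (Sum.elim (fun _ => Sum.inl (Sum.inr (Sum.inr false))) Sum.inr))))
  have hE : ∀ (x y : M),
      E.Realize (Sum.elim (fun _ => x) (Sum.elim q fun i => cond i a y)) ↔
        x ∈ X ∧ ∀ t : γ → M, (∀ j, t j < a) →
          (φ.Realize (Sum.elim (fun _ => x) t) ↔ φ.Realize (Sum.elim (fun _ => y) t)) := by
    intro x y
    let w : Unit ⊕ (β ⊕ Bool) → M := Sum.elim (fun _ => x) (Sum.elim q fun i => cond i a y)
    have key₁ : w ∘ Sum.map id Sum.inl = Sum.elim (fun _ => x) q := by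
      ext (_ | _) <;> rfl
    have key₂ : ∀ t : γ → M, (fun a => Sum.elim w t a) ∘
        Sum.elim (fun i => Sum.inl (Sum.inl i)) Sum.inr = Sum.elim (fun _ => x) t := by
      intro t
      ext (_ | _) <;> rfl
    have key₃ : ∀ t : γ → M, (fun a => Sum.elim w t a) ∘
        Sum.elim (fun _ => Sum.inl (Sum.inr (Sum.inr false))) Sum.inr =
          Sum.elim (fun _ : Unit => y) t := by
      intro t
      ext (_ | _) <;> rfl
    change E.Realize w ↔ _
    simp only [E, Formula.realize_inf, Formula.realize_iAlls, Formula.realize_imp,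
      Formula.realize_iff, Formula.realize_relabel, key₁, key₂, key₃, Formula.realize_iInf,
      realize_ltFormula, hlt, Sum.elim_inl, Sum.elim_inr, hψ, w, cond_true]
  obtain ⟨z₁, hz₁, hrep⟩ := hM.exists_forall_exists_lt hlt φ a
  -- Below `z₂` lie `q`, `a` and all representatives `y < z₁`, so `B` bounds every bounded class.
  -- The class of a point `x ∈ X` with `x ≥ B` is therefore unbounded.
  obtain ⟨z₂, hz₂⟩ := exists_forall_lt_of_finite (Sum.elim q fun _ : Unit => z₁)
  have hz₁₂ : z₁ < z₂ := hz₂ (Sum.inr ())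
  obtain ⟨B, hB⟩ := hM.exists_uniform_bound hlt E z₂
  obtain ⟨x, hBx, hx⟩ := frequently_atTop.1 hXu B
  obtain ⟨y, hy, hxy⟩ := hrep x
  refine ⟨{x | E.Realize (Sum.elim (fun _ => x) (Sum.elim q fun i => cond i a y))},
    fun x hx => ((hE _ _).1 hx).1, ⟨_, inferInstance, E, _, fun x => Iff.rfl⟩,
    frequently_atTop.2 fun b => ?_, fun x₁ h₁ x₂ h₂ t ht => ?_⟩
  · by_contra! hb
    refine (hB (Sum.elim q fun i => cond i a y) ?_ ⟨b, fun x' hx' => ?_⟩ x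
      ((hE _ _).2 ⟨hx, hxy⟩)).not_ge hBx
    · rintro (j | (_ | _))
      · exact hz₂ (Sum.inl j)
      · exact hy.trans hz₁₂
      · exact hz₁.trans hz₁₂
    · exact lt_of_not_ge fun h => hb x' h hx'
  · exact (((hE _ _).1 h₁).2 t ht).trans (((hE _ _).1 h₂).2 t ht).symm

/-- In a model of the inaccessibility scheme of countable cofinality there is an ultrafilter of
unbounded sets modulo which every bounded term function is constant. -/
theorem Inaccessible.exists_ultrafilter [Countable L.Symbols] (hM : Inaccessible lt M)
    (hlt : ∀ a b : M, Lt lt a b ↔ a < b) [NoMaxOrder M] [Nonempty M]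
    (a : ℕ → M) (ha : ∀ x, ∃ n, x ≤ a n) :
    ∃ U : Ultrafilter M, (U : Filter M) ≤ atTop ∧
      ∀ (k : ℕ) (t : L.Term (Fin k ⊕ Unit)) (p : Fin k → M) (b : M),
        (∀ᶠ x in (U : Filter M), t.realize (Sum.elim p fun _ => x) < b) →
          ∃ s, ∀ᶠ x in (U : Filter M), t.realize (Sum.elim p fun _ => x) = s := by
  let A : Type u := (Σ k : ℕ, L.Term (Fin k ⊕ Unit)) × ℕ
  have : Countable (Σ l, L.Functions l) :=
    Function.Injective.countable (β := L.Symbols) Sum.inl_injective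
  have : Nonempty A := ⟨⟨1, Term.var (Sum.inr ())⟩, 0⟩
  obtain ⟨d, hd⟩ := exists_surjective_nat A
  have hstep : ∀ (X : {X : Set M // ParamDefinable L X ∧ ∃ᶠ x in atTop, x ∈ X}) (i : A),
      ∃ Y : {X : Set M // ParamDefinable L X ∧ ∃ᶠ x in atTop, x ∈ X}, Y.1 ⊆ X.1 ∧
        ∀ x ∈ Y.1, ∀ x' ∈ Y.1, ∀ p, (∀ j, p j < a i.2) → ∀ s < a i.2,
          i.1.2.realize (Sum.elim p fun _ => x) = s →
            i.1.2.realize (Sum.elim p fun _ => x') = s := by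
    rintro ⟨X, hX, hXu⟩ ⟨⟨k, t⟩, n⟩
    -- Homogeneity for `t(p, x) = s` below `a n`: a value `s < a n` taken at one point of `Y` is
    -- taken at all of them.
    let φ : L.Formula (Unit ⊕ (Fin k ⊕ Unit)) :=
      (t.relabel (Sum.elim (fun j => Sum.inr (Sum.inl j)) Sum.inl)).equal
        (Term.var (Sum.inr (Sum.inr ())))
    obtain ⟨Y, hYX, hY, hYu, h⟩ := hM.exists_homogeneous hlt hX hXu φ (a n)
    refine ⟨⟨Y, hY, hYu⟩, hYX, fun x hx x' hx' p hp s hs => ?_⟩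
    have key : ∀ x : M, (Sum.elim (fun _ => x) (Sum.elim p fun _ : Unit => s)) ∘
        Sum.elim (fun j => Sum.inr (Sum.inl j)) Sum.inl = Sum.elim p fun _ : Unit => x := by
      intro x
      ext (_ | _) <;> rfl
    have := h x hx x' hx' (Sum.elim p fun _ => s) (by rintro (j | _); exacts [hp j, hs])
    simp only [φ, Formula.realize_equal, Term.realize_relabel, key, Term.realize_var,
      Sum.elim_inr] at this
    exact this.1
  choose s hs₁ hs₂ using hstep
  have huniv : ParamDefinable L (Set.univ : Set M) :=
    ⟨Empty, inferInstance, ⊤, Empty.elim, fun x => by simp⟩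
  let X : ℕ → {X : Set M // ParamDefinable L X ∧ ∃ᶠ x in atTop, x ∈ X} := fun n =>
    Nat.rec ⟨Set.univ, huniv, frequently_atTop.2 fun b => ⟨b, le_rfl, trivial⟩⟩
      (fun n X => s X (d n)) n
  have hX : Antitone fun n => (X n).1 := antitone_nat_of_succ_le fun n => hs₁ _ _
  have : ∀ n, (atTop ⊓ 𝓟 (X n).1).NeBot := fun n => frequently_mem_iff_neBot.1 (X n).2.2
  -- The sets decrease and each one meets every tail, so together with the tails they generate a
  -- proper filter.
  have : (⨅ n, atTop ⊓ 𝓟 (X n).1).NeBot := by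
    refine iInf_neBot_of_directed' (Antitone.directed_ge fun m n h => ?_) this
    exact inf_le_inf_left _ (principal_mono.2 (hX h))
  have hU := Ultrafilter.of_le (⨅ n, atTop ⊓ 𝓟 (X n).1)
  set U := Ultrafilter.of (⨅ n, atTop ⊓ 𝓟 (X n).1)
  refine ⟨U, hU.trans ((iInf_le _ 0).trans inf_le_left), fun k t p b hb => ?_⟩
  -- Some `a n` exceeds both the parameters and the bound, so the stage that treated `(t, n)` forces
  -- constancy.
  obtain ⟨z, hz⟩ := exists_forall_lt_of_finite (Sum.elim p fun _ : Unit => b)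
  obtain ⟨n, hn⟩ := ha z
  obtain ⟨i, hi⟩ := hd ⟨⟨k, t⟩, n⟩
  have hXU : ∀ᶠ x in (U : Filter M), x ∈ (X (i + 1)).1 :=
    hU ((iInf_le (fun n => atTop ⊓ 𝓟 (X n).1) (i + 1)).trans inf_le_right
      (mem_principal_self (X (i + 1)).1))
  obtain ⟨x, hxb, hxX⟩ := (hb.and hXU).exists
  have hbn : b < a n := (hz (Sum.inr ())).trans_le hn
  have h := hs₂ (X i) (d i)
  rw [hi] at h
  refine ⟨_, hXU.mono fun x' hx' => h x ?_ x' ?_ p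
    (fun j => (hz (Sum.inl j)).trans_le hn) _ (hxb.trans hbn) rfl⟩
  · rw [← hi]; exact hxX
  · rw [← hi]; exact hx'

/-- If every element of `N` is the value of a term at elements of the range of `e` and `c`, then
countable cofinality of the range of `e` passes to `N`. -/
theorem Inaccessible.exists_cofinal_seq [Countable L.Symbols] (hM : Inaccessible lt M)
    (hlt : ∀ a b : M, Lt lt a b ↔ a < b) [NoMaxOrder M] [Nonempty M] {A : Type w} (e : A → M)
    (a : ℕ → M) (ha : ∀ x, ∃ n, e x ≤ a n) (ha' : ∀ i j, ∃ n, a i ≤ a n ∧ a j ≤ a n) (c : M)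
    (hc : ∀ x : M, ∃ (k : ℕ) (t : L.Term (Fin k ⊕ Unit)) (p : Fin k → A),
      t.realize (Sum.elim (e ∘ p) fun _ => c) = x) :
    ∃ b : ℕ → M, ∀ x, ∃ n, x ≤ b n := by
  let I : Type u := (Σ k : ℕ, L.Term (Fin k ⊕ Unit)) × ℕ
  have : Countable (Σ l, L.Functions l) :=
    Function.Injective.countable (β := L.Symbols) Sum.inl_injective
  have : Nonempty I := ⟨⟨1, Term.var (Sum.inr ())⟩, 0⟩
  obtain ⟨d, hd⟩ := exists_surjective_nat I
  have hbound : ∀ i : I, ∃ B : M, ∀ p : Fin i.1.1 → A, (∀ j, e (p j) ≤ a i.2) →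
      i.1.2.realize (Sum.elim (e ∘ p) fun _ => c) < B := by
    rintro ⟨⟨k, t⟩, n⟩
    obtain ⟨z, hz⟩ := exists_gt (max (a n) c)
    -- The sets `{x | t(r) = x}` are singletons, hence bounded, so the values of `t` at parameters
    -- below `z` have a common bound.
    obtain ⟨B, hB⟩ := hM.exists_uniform_bound hlt
      ((t.relabel Sum.inr).equal (Term.var (Sum.inl ()))) z
    refine ⟨B, fun p hp => hB (Sum.elim (e ∘ p) fun _ => c) ?_ ?_ _ ?_⟩
    · rintro (j | _)
      exacts [(hp j).trans_lt ((le_max_left _ _).trans_lt hz), (le_max_right _ _).trans_lt hz]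
    · obtain ⟨b, hb⟩ := exists_gt (t.realize (Sum.elim (e ∘ p) fun _ => c))
      refine ⟨b, fun x hx => ?_⟩
      simp only [Formula.realize_equal, Term.realize_relabel, Sum.elim_comp_inr, Term.realize_var,
        Sum.elim_inl] at hx
      exact hx ▸ hb
    · simp only [Formula.realize_equal, Term.realize_relabel, Sum.elim_comp_inr, Term.realize_var,
        Sum.elim_inl]
  choose B hB using hbound
  refine ⟨B ∘ d, fun x => ?_⟩
  obtain ⟨k, t, p, rfl⟩ := hc x
  have hdir : Directed (· ≤ ·) a := ha'
  choose n hn using fun j => ha (p j)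
  obtain ⟨m, hm⟩ := hdir.finite_le n
  obtain ⟨i, hi⟩ := hd ⟨⟨k, t⟩, m⟩
  refine ⟨i, ?_⟩
  rw [Function.comp, hi]
  exact (hB ⟨⟨k, t⟩, m⟩ p fun j => (hn j).trans (hm j)).le

end Scheme

/-! ### Skolem hulls and ultrapowers. -/

section Hull

variable {L : FirstOrder.Language.{u, v}} {M : Type w} [L.Structure M]

/-- Tarski–Vaught test: a Skolem term evaluated at elements of `S` gives a witness in `S`. -/
theorem HasSkolemFunctions.isElementary {T : L.Theory} (hT : HasSkolemFunctions T) [M ⊨ T]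
    (S : L.Substructure M) [Nonempty S] : S.IsElementary := by
  have : Nonempty M := ⟨(Classical.arbitrary S : S)⟩
  refine S.isElementary_of_exists fun n φ x a h => ?_
  -- Skolem terms are available only for nonempty tuples, so the variable `0` is a dummy, filled in
  -- `y` by an arbitrary element of `S`.
  let g : Fin (n + 1) → Fin (n + 1) ⊕ Unit := Fin.snoc (fun i => Sum.inl i.succ) (Sum.inr ())
  obtain ⟨t, ht⟩ := hT n (φ.toFormula.relabel (Sum.elim Empty.elim g))
  let y : Fin (n + 1) → S := Fin.cons (Classical.arbitrary S) x
  have key : ∀ b : M, (φ.toFormula.relabel (Sum.elim Empty.elim g)).Realize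
      (Sum.elim ((↑) ∘ y) fun _ => b) ↔ φ.Realize default (Fin.snoc ((↑) ∘ x) b : _ → M) := by
    intro b
    rw [Formula.realize_relabel, BoundedFormula.realize_toFormula]
    refine iff_of_eq (congrArg₂ _ (Subsingleton.elim _ _) (funext fun i => ?_))
    refine Fin.lastCases ?_ (fun i => ?_) i <;> simp [g, y]
  have h' := ht.realize_formula M (v := (↑) ∘ y)
  rw [Formula.realize_imp, Formula.realize_iExs] at h'
  have h'' := h' ⟨fun _ => a, (key a).2 h⟩
  refine ⟨⟨t.realize fun i => (y i : M), t.realize_mem _ fun i => (y i).2⟩, (key _).1 ?_⟩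
  rw [Formula.Realize, BoundedFormula.realize_subst] at h''
  rw [Formula.Realize]
  convert! h'' using 1
  ext (_ | _) <;> rfl

theorem exists_term_of_mem_closure {A : Type w} (e : A → M) (c : M) {x : M}
    (hx : x ∈ Substructure.closure L (Set.range e ∪ {c})) :
    ∃ (k : ℕ) (t : L.Term (Fin k ⊕ Unit)) (p : Fin k → A),
      t.realize (Sum.elim (e ∘ p) fun _ => c) = x := by
  classical
  obtain ⟨t, rfl⟩ := Substructure.mem_closure_iff_exists_term.1 hx
  have hf : ∀ i : (Set.range e ∪ {c} : Set M), ∃ j : A ⊕ Unit, Sum.elim e (fun _ => c) j = i := by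
    rintro ⟨_, ⟨a, rfl⟩ | rfl⟩
    exacts [⟨Sum.inl a, rfl⟩, ⟨Sum.inr (), rfl⟩]
  choose f hf using hf
  let t₁ := t.relabel f
  let s : Finset A := t₁.varFinsetLeft
  refine ⟨s.card, (t₁.restrictVarLeft (s.equivFin)), fun i => (s.equivFin.symm i : s), ?_⟩
  rw [Term.realize_restrictVarLeft e (by simp), Sum.elim_comp_inr, Term.realize_relabel]
  exact congrArg (fun v => t.realize v) (funext hf)

theorem lt_product_iff {lt : L.Relations 2} [Nonempty M] {A : Type w} {U : Ultrafilter A}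
    {f g : A → M} :
    Lt lt (f : (U : Filter A).Product fun _ => M) (g : (U : Filter A).Product fun _ => M) ↔
      ∀ᶠ x in (U : Filter A), Lt lt (f x) (g x) := by
  have h := Ultraproduct.realize_formula_cast (u := U) (M := fun _ => M) (ltFormula lt true false)
    fun i => cond i f g
  exact (realize_ltFormula.symm.trans h).trans
    (eventually_congr (Eventually.of_forall fun _ => realize_ltFormula))

theorem lt_map_iff {lt : L.Relations 2} {N : Type w} [L.Structure N] (f : M ↪ₑ[L] N) {a b : M} :
    Lt lt (f a) (f b) ↔ Lt lt a b := by
  have h := f.map_rel lt ![a, b]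
  rwa [show f ∘ ![a, b] = ![f a, f b] by ext i; fin_cases i <;> rfl] at h

theorem mk_closure_insert_le [Countable L.Symbols] {A : Type w} [Infinite A] (e : A → M) (c : M) :
    Cardinal.mk (Substructure.closure L (Set.range e ∪ {c})) ≤ Cardinal.mk A := by
  have hA := Cardinal.aleph0_le_mk A
  have : Countable (Σ l, L.Functions l) :=
    Function.Injective.countable (β := L.Symbols) Sum.inl_injective
  rw [← Cardinal.lift_le.{u}]
  refine Substructure.lift_card_closure_le.trans (max_le (by simp) ?_)
  refine Cardinal.add_le_of_le (by simp) (Cardinal.lift_le.2 ?_) ?_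
  · refine (Cardinal.mk_union_le _ _).trans (Cardinal.add_le_of_le hA Cardinal.mk_range_le ?_)
    rw [Cardinal.mk_singleton]
    exact Cardinal.one_le_aleph0.trans hA
  · have h : Cardinal.mk (Σ l, L.Functions l) ≤ Cardinal.aleph0 := Cardinal.mk_le_aleph0
    exact (Cardinal.lift_le_aleph0.2 h).trans (by simp)

end Hull

end InaccScheme

/-! ### Construction of the end extension. -/

theorem theorem1p2 {L : FirstOrder.Language.{u, v}} [Countable L.Symbols]
    (lt : L.Relations 2) (T : L.Theory) (hcomplete : T.IsComplete)
    (hlin : InaccScheme.ProvesLinearOrder T lt)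
    (hskolem : InaccScheme.HasSkolemFunctions T)
    (hscheme : InaccScheme.InaccessibilityScheme T lt)
    (M : Type w) [L.Structure M] [M ⊨ T]
    (hcof : InaccScheme.HasCofinality lt M Cardinal.aleph0) :
    ∃ (N : Type w) (_ : L.Structure N) (e : M ↪ₑ[L] N),
      InaccScheme.IsElementaryEndExtension lt e ∧
        Cardinal.mk N = Cardinal.mk M ∧
        InaccScheme.HasCofinality lt N Cardinal.aleph0 := by
  open InaccScheme FirstOrder FirstOrder.Language Filter in
  obtain ⟨a, ha⟩ := hcof.1.exists_seq
  have : Nonempty M := ⟨a 0⟩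
  let _ := linearOrder hlin M
  have hltM : ∀ a b : M, Lt lt a b ↔ a < b := fun _ _ => Iff.rfl
  have hM : Inaccessible lt M := fun m k φ => (hscheme m k φ).realize_sentence M
  have := hM.noMaxOrder hltM
  have ha' : ∀ x, ∃ n, x ≤ a n := fun x => (ha x).imp fun n hn =>
    hn.elim (fun h => ((hltM _ _).1 h).le) le_of_eq
  obtain ⟨U, hUtop, hU⟩ := hM.exists_ultrafilter hltM a ha'
  let P : Type w := (U : Filter M).Product fun _ => M
  have : P ⊨ T := T.model_iff.2 fun φ hφ =>
    (Ultraproduct.sentence_realize φ).2 (Eventually.of_forall fun _ =>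
      T.realize_sentence_of_mem hφ)
  let e₀ : M → P := fun m => ((fun _ => m : M → M) : P)
  let c : P := ((id : M → M) : P)
  have hterm : ∀ {k : ℕ} (t : L.Term (Fin k ⊕ Unit)) (p : Fin k → M),
      t.realize (Sum.elim (e₀ ∘ p) fun _ => c) =
        ((fun x => t.realize (Sum.elim p fun _ => x) : M → M) : P) := by
    intro k t p
    refine Eq.trans ?_ (Ultraproduct.term_realize_cast (fun i x => Sum.elim p (fun _ => x) i) t)
    exact congrArg (fun v => t.realize v) (funext fun i => by cases i <;> rfl)
  have hformula : ∀ {n : ℕ} (φ : L.Formula (Fin n)) (x : Fin n → M),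
      φ.Realize (e₀ ∘ x) ↔ φ.Realize x := fun φ x =>
    (Ultraproduct.realize_formula_cast φ fun i _ => x i).trans eventually_const
  let S := Substructure.closure L (Set.range e₀ ∪ {c})
  have he₀ : ∀ m, e₀ m ∈ S := fun m => Substructure.subset_closure (Or.inl ⟨m, rfl⟩)
  have hc : c ∈ S := Substructure.subset_closure (Or.inr rfl)
  have : Nonempty S := ⟨⟨c, hc⟩⟩
  let S' : L.ElementarySubstructure P := ⟨S, hskolem.isElementary S⟩
  -- Both the diagonal map `M → P` (Łoś) and the inclusion `S' → P` preserve and reflect all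
  -- formulas.
  let e : M ↪ₑ[L] S' :=
    ⟨fun m => ⟨e₀ m, he₀ m⟩, fun n φ x =>
      (S'.subtype.map_formula φ _).symm.trans (hformula φ x)⟩
  have hS' : ∀ x : S', ∃ (k : ℕ) (t : L.Term (Fin k ⊕ Unit)) (p : Fin k → M),
      t.realize (Sum.elim (e₀ ∘ p) fun _ => c) = (x : P) := fun x =>
    exists_term_of_mem_closure e₀ c x.2
  let _ := linearOrder hlin S'
  have hltN : ∀ a b : S', Lt lt a b ↔ a < b := fun _ _ => Iff.rfl
  have hN : Inaccessible lt S' := fun m k φ => (hscheme m k φ).realize_sentence S'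
  have := hN.noMaxOrder hltN
  have hmono : StrictMono e := fun x y h => (hltN _ _).1 ((lt_map_iff e).2 h)
  refine ⟨S', inferInstance, e, ⟨⟨⟨c, hc⟩, ?_⟩, fun m b hb => ?_⟩, le_antisymm ?_ ?_, ?_⟩
  · rintro ⟨m, hm⟩
    have hm' : e₀ m = c := congrArg Subtype.val hm
    -- If `c` were in `M`, the identity would be constant mod `U`, but `U` contains all tails.
    have h₁ : ∀ᶠ x in (U : Filter M), m = x := Quotient.exact hm'
    obtain ⟨x, hx, hx'⟩ := (h₁.and (hUtop (eventually_gt_atTop m))).exists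
    exact hx'.ne hx
  · by_contra hmb
    obtain ⟨k, t, p, h⟩ := hS' b
    -- Only `b ≤ e m` is known; passing to `m' > m` gives the strict bound that `hU` needs.
    obtain ⟨m', hm'⟩ := exists_gt m
    have hbm : b < e m' := (not_lt.1 ((hltN _ _).not.1 hmb)).trans_lt
      (hmono hm')
    have hbm' : Lt lt (b : P) (e₀ m') := (lt_map_iff S'.subtype).2 hbm
    rw [← h, hterm] at hbm'
    obtain ⟨s, hs⟩ := hU k t p m' (lt_product_iff.1 hbm')
    refine hb ⟨s, Subtype.ext ?_⟩
    rw [← h, hterm]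
    exact (Quotient.sound hs).symm
  · have : Infinite M := NoMaxOrder.infinite
    exact mk_closure_insert_le e₀ c
  · exact Cardinal.mk_le_of_injective e.injective
  · obtain ⟨b, hb⟩ := hN.exists_cofinal_seq hltN e (fun n => e (a n))
      (fun x => (ha' x).imp fun n hn => hmono.monotone hn)
      (fun i j => (ha' (max (a i) (a j))).imp fun n hn =>
        ⟨hmono.monotone ((le_max_left _ _).trans hn), hmono.monotone ((le_max_right _ _).trans hn)⟩)
      ⟨c, hc⟩ fun x => by
        obtain ⟨k, t, p, h⟩ := hS' x
        refine ⟨k, t, p, Subtype.ext ?_⟩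
        rw [← h]
        refine (HomClass.realize_term S'.subtype).symm.trans ?_
        exact congrArg (fun v => t.realize v) (funext fun i => by cases i <;> rfl)
    exact hasCofinality_aleph0 hltN b hb
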